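/- Let $d\ge 1$ and $p\in[0,1]$, and consider bond percolation with parameter $p$ on the hypercubic lattice $\mathbb{L}^d=(\mathbb{Z}^d,\mathbb{E}^d)$, where $\mathbb{E}^d$ is the set of pairs of vertices differing by a unit coordinate vector: each edge is independently open with probability $p$ and closed otherwise. The open clusters are the connected components of the graph formed by $\mathbb{Z}^d$ and the open edges. Let $X\subseteq\mathbb{Z}^d$ be the random set of all vertices that lie in finite open clusters, regarded as the subgraph of $\mathbb{L}^d$ induced by $X$ (with all edges of $\mathbb{E}^d$, open or closed, having both endpoints in $X$). Then either almost surely $X$ has no infinite connected component, or almost surely $X$ has exactly one infinite connected component. -/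

import Mathlib

open MeasureTheory ProbabilityTheory

noncomputable section

namespace FiniteClusters

/-- The hypercubic lattice: the graph on `ℤ^d` whose edges are the pairs `{x, x + u_i}`,
where `u_i` is the `i`-th unit vector. -/
def lattice (d : ℕ) : SimpleGraph (Fin d → ℤ) where
  Adj x y := ∃ i : Fin d, y = x + Pi.single i 1 ∨ x = y + Pi.single i 1
  symm := ⟨fun _ _ ⟨i, h⟩ => ⟨i, h.symm⟩⟩
  loopless := ⟨fun _ ⟨i, h⟩ => by simp at h⟩

/-- Percolation configurations: each edge of the lattice is open (`true`) or closed (`false`). -/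
abbrev Config (d : ℕ) : Type := (lattice d).edgeSet → Bool

/-- Bond percolation with parameter `p`: the product measure on configurations under which each
edge is open with probability `p` and closed with probability `1 - p`. -/
def percolation (d : ℕ) (p : unitInterval) : Measure (Config d) :=
  Measure.infinitePi fun _ => bernoulliMeasure true false p

variable {d : ℕ}

/-- The spanning subgraph of the lattice formed by the open edges. -/
def openGraph (ω : Config d) : SimpleGraph (Fin d → ℤ) where
  Adj x y := ∃ h : (lattice d).Adj x y, ω ⟨s(x, y), h⟩ = true
  symm := ⟨fun x y ⟨h, hω⟩ => ⟨h.symm, by simpa only [Sym2.eq_swap] using hω⟩⟩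
  loopless := ⟨fun _ ⟨h, _⟩ => (lattice d).loopless.irrefl _ h⟩

/-- The vertex set of the open cluster of `x`. -/
def cluster (ω : Config d) (x : Fin d → ℤ) : Set (Fin d → ℤ) :=
  {y | (openGraph ω).Reachable x y}

/-- The set `X` of vertices that lie in finite open clusters. -/
def finiteClusterSet (ω : Config d) : Set (Fin d → ℤ) :=
  {x | (cluster ω x).Finite}

/-- `X` as a graph: all lattice edges (open or closed) with both endpoints in `X`. -/
def finiteClusterGraph (ω : Config d) : SimpleGraph (finiteClusterSet ω) :=
  (lattice d).induce (finiteClusterSet ω)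

end FiniteClusters

end

/-! This is a Burton–Keane argument for `finiteGraph`, in which closing edges plays the role that
opening edges plays for ordinary percolation. Closing all edges at a finite set `Λ` puts `Λ` into
`X`, removes nothing from `X`, and adds only finitely many vertices (`finiteClusterSet_closeAt`).
For `p ≠ 1` this operation pulls null events back to null events
(`measure_preimage_closeAt_eq_zero`).

Suppose `X` has at least two infinite components. If there are exactly two, a connected `Λ` meeting
both merges them into the only one. If there are at least three, a `Λ` meeting three of them creates
a trifurcation (`exists_finite_merging`). Trifurcations have probability zero: disjoint ones in a
box are at most as many as the points of a boundary shell (`card_trifurcations_le`), whereas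
translation invariance makes their expected number proportional to the volume
(`measure_isTrifurcation_eq_zero`).

The event of exactly one infinite component is translation invariant, hence has probability 0 or 1.
If 0, both possible results of a modification are null, so almost surely there are not two or more
infinite components, nor exactly one, hence none (`ae_no_infinite`). The number of components need
not be shown constant, and infinitely many are covered by the case of three. For `p = 1` the set `X`
is empty. -/

noncomputable section

namespace FiniteClusters

/-! ### Branches at finite connected sets, and counting trifurcations -/

section Graph

variable {V : Type*} {G H : SimpleGraph V} {A B K : Set V} {x y z : V}

/-- The graph `G` with all edges removed that do not have both endpoints in `A`. -/
def within (G : SimpleGraph V) (A : Set V) : SimpleGraph V where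
  Adj x y := G.Adj x y ∧ x ∈ A ∧ y ∈ A
  symm := ⟨fun _ _ h => ⟨h.1.symm, h.2.2, h.2.1⟩⟩
  loopless := ⟨fun _ h => G.loopless.irrefl _ h.1⟩

lemma within_le : within G A ≤ G := fun _ _ h => h.1

lemma within_mono (h : A ⊆ B) : within G A ≤ within G B := fun _ _ h' =>
  ⟨h'.1, h h'.2.1, h h'.2.2⟩

lemma reachable_induction {P : V → Prop} (h : G.Reachable x y) (hx : P x)
    (step : ∀ u v, G.Reachable x u → G.Adj u v → P u → P v) : P y := by
  rw [SimpleGraph.reachable_iff_reflTransGen] at h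
  induction h with
  | refl => exact hx
  | tail hu huv ih => exact step _ _ ((SimpleGraph.reachable_iff_reflTransGen _ _).2 hu) huv ih

lemma reachable_of_adj (h : G.Adj x y) : G.Reachable x y := h.reachable

lemma mem_of_reachable_within (h : (within G A).Reachable x y) (hx : x ∈ A) : y ∈ A :=
  reachable_induction h hx fun _ _ _ h _ => h.2.2

lemma eq_of_reachable_within (h : (within G A).Reachable x y) (hx : x ∉ A) : y = x :=
  reachable_induction (P := fun y => y = x) h rfl fun _ _ _ h e => absurd (e ▸ h.2.1 : x ∈ A) hx

lemma mem_of_infinite_within (h : {z | (within G A).Reachable x z}.Infinite) : x ∈ A := by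
  by_contra hx
  exact h ((Set.finite_singleton x).subset fun z hz => eq_of_reachable_within hz hx)

/-- A path from outside `K` into `K` has a first entry point. -/
lemma exists_entry (hx : x ∉ K) (hz : z ∈ K) (h : G.Reachable x z) :
    ∃ y ∉ K, ∃ k ∈ K, G.Adj y k ∧ (within G Kᶜ).Reachable x y := by
  by_contra! hc
  have : z ∉ K ∧ (within G Kᶜ).Reachable x z := by
    refine reachable_induction (P := fun z => z ∉ K ∧ (within G Kᶜ).Reachable x z) h ⟨hx, .rfl⟩ fun u v _ huv hu => ?_
    have hv : v ∉ K := fun hv => hc u hu.1 v hv huv hu.2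
    exact ⟨hv, hu.2.trans (reachable_of_adj ⟨huv, hu.1, hv⟩)⟩
  exact this.1 hz

lemma reachable_within_compl (h : G.Reachable x y) (hK : ∀ k ∈ K, ¬ G.Reachable x k) :
    (within G Kᶜ).Reachable x y :=
  reachable_induction h .rfl fun u v hu huv ih => ih.trans <| reachable_of_adj
    ⟨huv, fun hk => hK u hk hu, fun hk => hK v hk (hu.trans huv.reachable)⟩

/-- Removing finitely many vertices from an infinite component of a locally finite graph leaves
an infinite component. -/
lemma exists_infinite_within_compl (hG : ∀ v, (G.neighborSet v).Finite) (hK : K.Finite)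
    (h : {z | G.Reachable x z}.Infinite) :
    ∃ y, G.Reachable x y ∧ {z | (within G Kᶜ).Reachable y z}.Infinite := by
  by_cases hx : ∃ k ∈ K, G.Reachable x k
  · obtain ⟨k, hk, hxk⟩ := hx
    by_contra! hc
    -- Every vertex of the component outside `K` is joined, off `K`, to one of the finitely many
    -- neighbours of `K`; if all those pieces were finite, so would be the component.
    refine h (((hK.biUnion fun k _ => hG k).inter_of_left {y | G.Reachable x y}).biUnion
      (t := fun y => {z | (within G Kᶜ).Reachable y z}) (fun y hy => by
        simpa using hc y hy.2) |>.union hK |>.subset ?_)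
    intro z hz
    by_cases hzK : z ∈ K
    · exact .inr hzK
    obtain ⟨y, hy, k', hk', hyk, hzy⟩ := exists_entry hzK hk (hz.symm.trans hxk)
    refine .inl (Set.mem_biUnion (x := y) ⟨Set.mem_biUnion hk' hyk.symm, ?_⟩ hzy.symm)
    exact hz.trans (hzy.mono within_le)
  · push Not at hx
    exact ⟨x, .rfl, h.mono fun z hz => reachable_within_compl hz hx⟩

/-- `K` is a finite connected set whose removal leaves (at least) three infinite components in
its own component. -/
def IsTrifurcation (G : SimpleGraph V) (K : Set V) : Prop :=
  (∀ a ∈ K, ∀ b ∈ K, (within G K).Reachable a b) ∧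
  ∃ k ∈ K, ∃ s : Fin 3 → V, (∀ u, {z | (within G Kᶜ).Reachable (s u) z}.Infinite ∧
    G.Reachable (s u) k) ∧ ∀ u v, u ≠ v → ¬ (within G Kᶜ).Reachable (s u) (s v)

/-- If `a` and the connected set `K'` lie in different branches at `K`, then `a` and `K` lie in
the same branch at `K'`. -/
lemma reachable_within_compl_of_not {K K' : Set V} {a k k' : V}
    (hK : ∀ a ∈ K, ∀ b ∈ K, (within G K).Reachable a b)
    (hK' : ∀ a ∈ K', ∀ b ∈ K', (within G K').Reachable a b) (hd : Disjoint K K')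
    (hk : k ∈ K) (hk' : k' ∈ K') (ha : a ∉ K) (hak : G.Reachable a k)
    (hn : ¬ (within G Kᶜ).Reachable a k') : (within G K'ᶜ).Reachable a k := by
  have key : ∀ z, (within G Kᶜ).Reachable a z → z ∉ K' := fun z hz hz' =>
    hn (hz.trans ((hK' z hz' k' hk').mono (within_mono fun w hw hw' =>
      Set.disjoint_left.1 hd hw' hw)))
  obtain ⟨y, hy, l, hl, hyl, hay⟩ := exists_entry ha hk hak
  have h1 : (within G K'ᶜ).Reachable a y :=
    reachable_induction hay .rfl fun u v hu huv ih => ih.trans <| reachable_of_adj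
      ⟨huv.1, key u hu, key v (hu.trans huv.reachable)⟩
  exact (h1.trans (reachable_of_adj ⟨hyl, key y hay, Set.disjoint_left.1 hd hl⟩)).trans
    ((hK l hl k hk).mono (within_mono fun w hw => Set.disjoint_left.1 hd hw))

/-- If every member of a disjoint family of connected sets separates three points of `S`
in its component, then the family has at most as many members as `S`. -/
theorem card_le_of_branching {ι : Type*} [DecidableEq ι] [DecidableEq V] {K : ι → Set V}
    {k : ι → V} (J : Finset ι) (S : Finset V) (hk : ∀ j ∈ J, k j ∈ K j)
    (hK : ∀ j ∈ J, ∀ a ∈ K j, ∀ b ∈ K j, (within G (K j)).Reachable a b)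
    (hd : ∀ i ∈ J, ∀ j ∈ J, i ≠ j → Disjoint (K i) (K j))
    (hs : ∀ j ∈ J, ∃ s : Fin 3 → V, (∀ u, s u ∈ S ∧ s u ∉ K j ∧ G.Reachable (s u) (k j)) ∧
      ∀ u v, u ≠ v → ¬ (within G (K j)ᶜ).Reachable (s u) (s v)) :
    J.card ≤ S.card := by
  classical
  induction hn : J.card generalizing J S with
  | zero => simp
  | succ n ih =>
  -- `m j a` counts the members `l` of `J` whose `k l` lies in the branch of `a` at `K j`. Choosing
  -- `(j, a)` with the largest count makes `j` a leaf: all its other branches contain no member.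
  let m : ι → V → ℕ := fun j a =>
    (J.filter fun l => l ≠ j ∧ (within G (K j)ᶜ).Reachable a (k l)).card
  let Q : Set ℕ := {n | ∃ j ∈ J, ∃ a, a ∉ K j ∧ G.Reachable a (k j) ∧ m j a = n}
  have hQb : BddAbove Q := ⟨J.card, by
    rintro _ ⟨j, -, a, -, -, rfl⟩; exact Finset.card_filter_le _ _⟩
  have hQn : Q.Nonempty := by
    obtain ⟨j, hj⟩ : J.Nonempty := Finset.card_pos.1 (by omega)
    obtain ⟨s, h1, -⟩ := hs j hj
    exact ⟨_, j, hj, s 0, (h1 0).2.1, (h1 0).2.2, rfl⟩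
  obtain ⟨j, hj, a, haj, hak, hmax⟩ := Nat.sSup_mem hQn hQb
  have hmax' : ∀ i ∈ J, ∀ b, b ∉ K i → G.Reachable b (k i) → m i b ≤ m j a :=
    fun i hi b hb hbi => hmax ▸ le_csSup hQb ⟨i, hi, b, hb, hbi, rfl⟩
  obtain ⟨s, h1, h2⟩ := hs j hj
  have claim : ∀ u, ¬ (within G (K j)ᶜ).Reachable a (s u) → ∀ i ∈ J, i ≠ j →
      ¬ (within G (K j)ᶜ).Reachable (s u) (k i) := by
    intro u hu i hi hij hui
    have hai : ¬ (within G (K j)ᶜ).Reachable a (k i) := fun h => hu (h.trans hui.symm)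
    have hdij : Disjoint (K j) (K i) := hd j hj i hi hij.symm
    have hkj : G.Reachable (k j) (k i) :=
      ((h1 u).2.2.symm).trans (hui.mono within_le)
    -- Seen from `K i`, the branch towards `K j` contains everything counted by `m j a`, and `j` as
    -- well.
    have hlt : m j a < m i (k j) := by
      refine Finset.card_lt_card (Finset.ssubset_iff_of_subset ?_ |>.2 ⟨j, ?_, ?_⟩)
      · intro l hl
        simp only [Finset.mem_filter] at hl ⊢
        obtain ⟨hlJ, hlj, hal⟩ := hl
        refine ⟨hlJ, ?_, ?_⟩
        · rintro rfl; exact hai hal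
        · refine (reachable_within_compl_of_not (hK j hj) (hK i hi) hdij (hk j hj) (hk i hi)
            ?_ ?_ ?_).symm
          · exact Set.disjoint_left.1 (hd l hlJ j hj hlj) (hk l hlJ)
          · exact (hal.mono within_le).symm.trans hak
          · exact fun h => hai (hal.trans h)
      · simp only [Finset.mem_filter]
        exact ⟨hj, hij.symm, .rfl⟩
      · simp
    exact absurd (hmax' i hi (k j) (Set.disjoint_left.1 hdij (hk j hj)) hkj) (not_le.2 hlt)
  -- At most one of the three branches is that of `a`, so two are free of members. The induction
  -- drops `j` together with the point `s u` of one of them.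
  obtain ⟨u, v, huv, hu, hv⟩ : ∃ u v, u ≠ v ∧ ¬ (within G (K j)ᶜ).Reachable a (s u) ∧
      ¬ (within G (K j)ᶜ).Reachable a (s v) := by
    have h3 : ∀ u v, u ≠ v → (within G (K j)ᶜ).Reachable a (s u) →
        ¬ (within G (K j)ᶜ).Reachable a (s v) := fun u v huv hu hv =>
      h2 u v huv (hu.symm.trans hv)
    by_cases h0 : (within G (K j)ᶜ).Reachable a (s 0)
    · exact ⟨1, 2, by decide, h3 0 1 (by decide) h0, h3 0 2 (by decide) h0⟩
    by_cases h01 : (within G (K j)ᶜ).Reachable a (s 1)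
    · exact ⟨0, 2, by decide, h0, h3 1 2 (by decide) h01⟩
    · exact ⟨0, 1, by decide, h0, h01⟩
  have hsuv : s u ≠ s v := fun h => h2 u v huv (h ▸ .rfl)
  have hcard := ih (J.erase j) (S.erase (s u))
    (fun i hi => hk i (Finset.mem_of_mem_erase hi))
    (fun i hi => hK i (Finset.mem_of_mem_erase hi))
    (fun i hi l hl => hd i (Finset.mem_of_mem_erase hi) l (Finset.mem_of_mem_erase hl)) ?_
    (by rw [Finset.card_erase_of_mem hj]; omega)
  · rw [Finset.card_erase_of_mem (h1 u).1] at hcard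
    have := Finset.card_pos.2 ⟨_, (h1 u).1⟩
    omega
  intro i hi
  obtain ⟨hij, hi⟩ := Finset.mem_erase.1 hi
  have hback : ∀ w, ¬ (within G (K j)ᶜ).Reachable a (s w) →
      (within G (K i)ᶜ).Reachable (s w) (k j) := fun w hw =>
    reachable_within_compl_of_not (hK j hj) (hK i hi) (hd j hj i hi hij.symm) (hk j hj)
      (hk i hi) (h1 w).2.1 (h1 w).2.2 (claim w hw i hi hij)
  have hr : (within G (K i)ᶜ).Reachable (s v) (s u) := (hback v hv).trans (hback u hu).symm
  obtain ⟨t, ht1, ht2⟩ := hs i hi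
  -- All other members see `s u` and `s v` in the same branch, so `s v` can replace the erased
  -- point.
  have hf : ∀ w, (within G (K i)ᶜ).Reachable (if t w = s u then s v else t w) (t w) := by
    intro w
    split_ifs with h
    · rw [h]; exact hr
    · exact .rfl
  refine ⟨fun w => if t w = s u then s v else t w, fun w => ⟨?_, ?_, ?_⟩, fun w w' hw h => ?_⟩
  · dsimp only
    split_ifs with h
    · exact Finset.mem_erase.2 ⟨hsuv.symm, (h1 v).1⟩
    · exact Finset.mem_erase.2 ⟨h, (ht1 w).1⟩
  · exact mem_of_reachable_within (hf w).symm (ht1 w).2.1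
  · exact ((hf w).mono within_le).trans (ht1 w).2.2
  · exact ht2 w w' hw ((hf w).symm.trans (h.trans (hf w')))

/-- If all neighbours of the finite set `B` lie in `A`, then an infinite component that meets `A`
meets the shell `A \ B`. -/
lemma exists_reachable_mem_diff (h : {z | G.Reachable x z}.Infinite) (hB : B.Finite)
    (hBA : ∀ u v, G.Adj u v → u ∈ B → v ∈ A) (hx : x ∈ A) :
    ∃ y, G.Reachable x y ∧ y ∈ A \ B := by
  by_contra! hc
  refine h (hB.subset fun z hz => ?_)
  have hxB : x ∈ B := by
    by_contra hxB; exact hc x .rfl ⟨hx, hxB⟩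
  refine reachable_induction hz hxB fun u v hu huv huB => ?_
  by_contra hvB
  exact hc v (hu.trans huv.reachable) ⟨hBA u v huv huB, hvB⟩

/-- Disjoint trifurcations inside `B` number at most the points of the shell `A \ B`. -/
theorem card_trifurcations_le [Nonempty V] {ι : Type*} [DecidableEq ι] [DecidableEq V] {K : ι → Set V}
    (J : Finset ι) (A B : Finset V) (hBA : ∀ u v, G.Adj u v → u ∈ B → v ∈ A)
    (hKB : ∀ j ∈ J, K j ⊆ B) (hK : ∀ j ∈ J, IsTrifurcation G (K j))
    (hd : ∀ i ∈ J, ∀ j ∈ J, i ≠ j → Disjoint (K i) (K j)) : J.card ≤ (A \ B).card := by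
  have h : ∀ j, ∃ k, j ∈ J → k ∈ K j ∧ ∃ s : Fin 3 → V,
      (∀ u, s u ∈ A \ B ∧ s u ∉ K j ∧ G.Reachable (s u) k) ∧
      ∀ u v, u ≠ v → ¬ (within G (K j)ᶜ).Reachable (s u) (s v) := by
    intro j
    by_cases hj : j ∈ J
    swap
    · exact ⟨Classical.arbitrary V, fun h => absurd h hj⟩
    obtain ⟨hc, k, hk, s, h1, h2⟩ := hK j hj
    -- Each branch contains a neighbour of `K j`, hence a point of `A`; being infinite, it cannot
    -- stay in `B`.
    have : ∀ u, ∃ t, (within G (K j)ᶜ).Reachable (s u) t ∧ t ∈ A \ B := by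
      intro u
      obtain ⟨y, hy, k', hk', hyk, hsy⟩ :=
        exists_entry (mem_of_infinite_within (h1 u).1) hk (h1 u).2
      have hi : {z | (within G (K j)ᶜ).Reachable y z}.Infinite :=
        (h1 u).1.mono fun z hz => hsy.symm.trans hz
      obtain ⟨t, ht, ht'⟩ := exists_reachable_mem_diff hi B.finite_toSet (A := A)
        (fun u v huv hu => hBA u v huv.1 hu) (hBA k' y hyk.symm (hKB j hj hk'))
      exact ⟨t, hsy.trans ht, by simpa using ht'⟩
    choose t ht ht' using this
    refine ⟨k, fun _ => ⟨hk, t, fun u => ⟨ht' u, ?_, ?_⟩, fun u v huv h => ?_⟩⟩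
    · exact mem_of_reachable_within (ht u) (mem_of_infinite_within (h1 u).1)
    · exact ((ht u).mono within_le).symm.trans (h1 u).2
    · exact h2 u v huv ((ht u).trans (h.trans (ht v).symm))
  choose k hk using h
  exact card_le_of_branching J _ (fun j hj => (hk j hj).1) (fun j hj => (hK j hj).1) hd
    (fun j hj => (hk j hj).2)

end Graph

/-! ### Enlarging the vertex set: merging infinite components -/

section Graph

variable {V : Type*} {G L O : SimpleGraph V} {X Y T Λ : Set V} {x y z : V}

lemma reachable_mono_within (h : X ⊆ Y) (hr : (within L X).Reachable x y) :
    (within L Y).Reachable x y := hr.mono (within_mono h)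

lemma exists_finite_connected_of_reachable (h : G.Reachable x y) :
    ∃ K : Set V, K.Finite ∧ x ∈ K ∧ y ∈ K ∧ ∀ a ∈ K, (within G K).Reachable x a := by
  refine reachable_induction (P := fun y => ∃ K : Set V, K.Finite ∧ x ∈ K ∧ y ∈ K ∧
    ∀ a ∈ K, (within G K).Reachable x a) h ⟨{x}, Set.finite_singleton x, rfl, rfl, ?_⟩ ?_
  · rintro a rfl
    exact .rfl
  · rintro u v - huv ⟨K, hK, hx, hu, hc⟩
    have hm : K ⊆ insert v K := Set.subset_insert v K
    refine ⟨insert v K, hK.insert v, .inr hx, .inl rfl, ?_⟩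
    rintro a (rfl | ha)
    · exact (reachable_mono_within hm (hc u hu)).trans (reachable_of_adj ⟨huv, .inr hu, .inl rfl⟩)
    · exact reachable_mono_within hm (hc a ha)

/-- Finitely many vertices of one component lie in a finite connected set. -/
lemma exists_finite_connected (hT : T.Finite) (h : ∀ y ∈ T, G.Reachable x y) :
    ∃ K : Set V, K.Finite ∧ T ⊆ K ∧ x ∈ K ∧ ∀ a ∈ K, ∀ b ∈ K, (within G K).Reachable a b := by
  choose! K hK hx hy hc using fun y hy => exists_finite_connected_of_reachable (h y hy)
  have hm : ∀ y ∈ T, K y ⊆ {x} ∪ ⋃ y ∈ T, K y := fun y hy =>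
    (Set.subset_biUnion_of_mem hy).trans Set.subset_union_right
  have hr : ∀ a ∈ {x} ∪ ⋃ y ∈ T, K y, (within G ({x} ∪ ⋃ y ∈ T, K y)).Reachable x a := by
    rintro a (rfl | ha)
    · exact .rfl
    · obtain ⟨y, hyT, ha⟩ := Set.mem_iUnion₂.1 ha
      exact reachable_mono_within (hm y hyT) (hc y hyT a ha)
  exact ⟨{x} ∪ ⋃ y ∈ T, K y, (Set.finite_singleton x).union (hT.biUnion hK),
    fun y hyT => hm y hyT (hy y hyT), .inl rfl, fun a ha b hb => (hr a ha).symm.trans (hr b hb)⟩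

/-- `x` lies in an infinite component of `G`. -/
def InInfinite (G : SimpleGraph V) (x : V) : Prop := {z | G.Reachable x z}.Infinite

/-- `G` has exactly one infinite component. -/
def HasUniqueInfinite (G : SimpleGraph V) : Prop :=
  ∃ x, InInfinite G x ∧ ∀ y, InInfinite G y → G.Reachable x y

lemma InInfinite.mono (h : InInfinite G x) (hG : G ≤ L) : InInfinite L x :=
  Set.Infinite.mono (fun _ hz => SimpleGraph.Reachable.mono hG hz) h

/-- The vertices that lie in finite components of `O`. -/
def finiteSet (O : SimpleGraph V) : Set V := {x | {y | O.Reachable x y}.Finite}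

lemma finiteSet_subset_within (A : Set V) : finiteSet O ⊆ finiteSet (within O A) := fun _ hx =>
  Set.Finite.subset hx fun _ hz => SimpleGraph.Reachable.mono within_le hz

lemma subset_finiteSet_within : Λ ⊆ finiteSet (within O Λᶜ) := fun x hx =>
  (Set.finite_singleton x).subset fun _ hz => eq_of_reachable_within hz (not_not.2 hx)

/-- Isolating finitely many vertices moves only finitely many vertices from infinite to finite
components. -/
lemma finite_finiteSet_within_diff (hO : ∀ v, (O.neighborSet v).Finite) (hΛ : Λ.Finite) :
    (finiteSet (within O Λᶜ) \ finiteSet O).Finite := by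
  have hN : (⋃ k ∈ Λ, O.neighborSet k).Finite := hΛ.biUnion fun k _ => hO k
  refine (hΛ.union ((hN.inter_of_left (finiteSet (within O Λᶜ))).biUnion
    (t := fun y => {z | (within O Λᶜ).Reachable y z}) fun y hy => hy.2)).subset ?_
  rintro x ⟨hx, hx'⟩
  by_cases hxΛ : x ∈ Λ
  · exact .inl hxΛ
  right
  by_cases h : ∃ k ∈ Λ, O.Reachable x k
  · obtain ⟨k, hk, hxk⟩ := h
    obtain ⟨y, -, k', hk', hyk, hxy⟩ := exists_entry hxΛ hk hxk
    refine Set.mem_biUnion (x := y) ⟨Set.mem_biUnion hk' hyk.symm, ?_⟩ hxy.symm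
    exact Set.Finite.subset hx fun z hz => hxy.trans hz
  · push Not at h
    exact absurd (Set.Finite.subset hx fun z hz => reachable_within_compl hz h) hx'

lemma neighborSet_within_finite (hL : ∀ v, (L.neighborSet v).Finite) (A : Set V) (v : V) :
    ((within L A).neighborSet v).Finite :=
  (hL v).subset fun _ h => h.1

/-- Removing the finite set `Y \ X` from an infinite component leaves an infinite piece lying in
`X`. Hence finitely many added vertices never create an infinite component out of finite ones. -/
lemma InInfinite.exists_of_finite_diff (hL : ∀ v, (L.neighborSet v).Finite)
    (hf : (Y \ X).Finite) (h : InInfinite (within L Y) x) :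
    ∃ y, (within L Y).Reachable x y ∧ InInfinite (within L X) y := by
  obtain ⟨y, hxy, hy⟩ := exists_infinite_within_compl (neighborSet_within_finite hL Y) hf h
  refine ⟨y, hxy, InInfinite.mono hy fun u v huv => ⟨huv.1.1, ?_, ?_⟩⟩
  · by_contra hu; exact huv.2.1 ⟨huv.1.2.1, hu⟩
  · by_contra hv; exact huv.2.2 ⟨huv.1.2.2, hv⟩

/-- Three infinite components joined by a finite connected set produce a trifurcation. -/
lemma exists_isTrifurcation (hL : ∀ v, (L.neighborSet v).Finite) (hXY : X ⊆ Y)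
    (hf : (Y \ X).Finite) (hΛf : Λ.Finite) (hΛY : Λ ⊆ Y)
    (hΛ : ∀ a ∈ Λ, ∀ b ∈ Λ, (within L Λ).Reachable a b) (s : Fin 3 → V) (hsΛ : ∀ u, s u ∈ Λ)
    (hs : ∀ u, InInfinite (within L X) (s u))
    (hs' : ∀ u v, u ≠ v → ¬ (within L X).Reachable (s u) (s v)) :
    ∃ K : Set V, K.Finite ∧ IsTrifurcation (within L Y) K := by
  have hΛ' : ∀ a ∈ Λ, (within L Y).Reachable (s 0) a := fun a ha =>
    reachable_mono_within hΛY (hΛ _ (hsΛ 0) a ha)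
  -- `K` must absorb all added vertices of this component, not only `Λ`: otherwise some of them
  -- could reconnect the branches outside `K`.
  obtain ⟨K, hKf, hTK, h0, hK⟩ := exists_finite_connected (G := within L Y) (x := s 0)
    (hΛf.union (hf.inter_of_left {z | (within L Y).Reachable (s 0) z}))
    (by rintro y (hy | hy); exacts [hΛ' y hy, hy.2])
  choose t ht ht' using fun u =>
    exists_infinite_within_compl (neighborSet_within_finite hL X) hKf (hs u)
  have ht0 : ∀ u, (within L Y).Reachable (s 0) (t u) := fun u =>
    (hΛ' _ (hsΛ u)).trans (reachable_mono_within hXY (ht u))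
  have hsub : within (within L X) Kᶜ ≤ within (within L Y) Kᶜ := fun a b hab =>
    ⟨within_mono hXY hab.1, hab.2⟩
  refine ⟨K, hKf, hK, s 0, h0, t, fun u => ⟨(ht' u).mono fun z hz =>
    SimpleGraph.Reachable.mono hsub hz, (ht0 u).symm⟩, fun u v huv h => hs' u v huv ?_⟩
  refine (ht u).trans (SimpleGraph.Reachable.trans ?_ (ht v).symm)
  have hX : ∀ w, (within L Y).Reachable (s 0) w → w ∈ Y → w ∉ K → w ∈ X := fun w hw hwY hwK => by
    by_contra hwX
    exact hwK (hTK (.inr ⟨⟨hwY, hwX⟩, hw⟩))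
  refine reachable_induction h .rfl fun a b ha hab ih => ih.trans (reachable_of_adj ?_)
  have ha0 := (ht0 u).trans (ha.mono within_le)
  exact ⟨hab.1.1, hX a ha0 hab.1.2.1 hab.2.1, hX b (ha0.trans (hab.1.reachable)) hab.1.2.2 hab.2.2⟩

/-- An infinite component over `Y` contains one over `X`, which is that of `a` or of `b`, and `Λ`
joins these two. -/
lemma hasUniqueInfinite_of_merge (hL : ∀ v, (L.neighborSet v).Finite) (hXY : X ⊆ Y)
    (hf : (Y \ X).Finite) (hΛY : Λ ⊆ Y)
    (hΛ : ∀ a ∈ Λ, ∀ b ∈ Λ, (within L Λ).Reachable a b) {a b : V} (ha : a ∈ Λ) (hb : b ∈ Λ)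
    (hai : InInfinite (within L X) a)
    (hab : ∀ c, InInfinite (within L X) c →
      (within L X).Reachable a c ∨ (within L X).Reachable b c) :
    HasUniqueInfinite (within L Y) := by
  refine ⟨a, hai.mono (within_mono hXY), fun y hy => ?_⟩
  obtain ⟨c, hyc, hc⟩ := hy.exists_of_finite_diff hL hf
  refine SimpleGraph.Reachable.trans ?_ hyc.symm
  rcases hab c hc with h | h
  · exact reachable_mono_within hXY h
  · exact (reachable_mono_within hΛY (hΛ a ha b hb)).trans (reachable_mono_within hXY h)

/-- If `within L X` has at least two infinite components, then after adding finitely many vertices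
that include a suitable finite set, the graph has one infinite component or a trifurcation. -/
lemma exists_finite_merging (hL : ∀ v, (L.neighborSet v).Finite) (hLc : L.Preconnected)
    (hi : ∃ x, InInfinite (within L X) x) (hu : ¬ HasUniqueInfinite (within L X)) :
    ∃ Λ : Set V, Λ.Finite ∧ ∀ Y, X ⊆ Y → (Y \ X).Finite → Λ ⊆ Y →
      HasUniqueInfinite (within L Y) ∨ ∃ K : Set V, K.Finite ∧ IsTrifurcation (within L Y) K := by
  obtain ⟨a, ha⟩ := hi
  obtain ⟨b, hb, hab⟩ : ∃ b, InInfinite (within L X) b ∧ ¬ (within L X).Reachable a b := by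
    by_contra! h
    exact hu ⟨a, ha, h⟩
  -- Exactly two infinite components, or at least three.
  by_cases h : ∀ c, InInfinite (within L X) c →
      (within L X).Reachable a c ∨ (within L X).Reachable b c
  · obtain ⟨Λ, hΛf, hΛ, haΛ, hΛc⟩ := exists_finite_connected (G := L) (x := a)
      (Set.finite_singleton b) fun y _ => hLc a y
    exact ⟨Λ, hΛf, fun Y hXY hf hΛY => .inl (hasUniqueInfinite_of_merge hL hXY hf hΛY hΛc haΛ
      (hΛ rfl) ha h)⟩
  · push Not at h
    obtain ⟨c, hc, hac, hbc⟩ := h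
    obtain ⟨Λ, hΛf, hΛ, -, hΛc⟩ := exists_finite_connected (G := L) (x := a)
      (Set.finite_range ![a, b, c]) fun y _ => hLc a y
    refine ⟨Λ, hΛf, fun Y hXY hf hΛY => .inr (exists_isTrifurcation hL hXY hf hΛf hΛY hΛc ![a, b, c]
      (fun u => hΛ ⟨u, rfl⟩) ?_ ?_)⟩
    · intro u
      fin_cases u
      exacts [ha, hb, hc]
    · intro u v huv
      fin_cases u <;> fin_cases v <;> first | exact absurd rfl huv | skip
      exacts [hab, hac, fun h => hab h.symm, hbc, fun h => hac h.symm, fun h => hbc h.symm]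

/-! ### Relabelling -/

variable {W : Type*}

lemma reachable_comap_iff (e : W ≃ V) {a b : W} :
    (G.comap e).Reachable a b ↔ G.Reachable (e a) (e b) :=
  (SimpleGraph.Iso.reachable_iff (φ := SimpleGraph.Iso.comap e G)).symm

lemma within_comap (e : W ≃ V) (A : Set V) : within (G.comap e) (e ⁻¹' A) = (within G A).comap e :=
  rfl

lemma infinite_comap_iff (e : W ≃ V) {a : W} :
    InInfinite (G.comap e) a ↔ InInfinite G (e a) := by
  have : {z | (G.comap e).Reachable a z} = e ⁻¹' {z | G.Reachable (e a) z} := by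
    ext z; exact reachable_comap_iff e
  rw [InInfinite, this, InInfinite, ← e.image_symm_eq_preimage,
    Set.infinite_image_iff e.symm.injective.injOn]

lemma finiteSet_comap (e : W ≃ V) : finiteSet (O.comap e) = e ⁻¹' finiteSet O := by
  ext a
  exact not_iff_not.1 (infinite_comap_iff e)

lemma hasUniqueInfinite_comap_iff (e : W ≃ V) :
    HasUniqueInfinite (G.comap e) ↔ HasUniqueInfinite G := by
  simp only [HasUniqueInfinite, infinite_comap_iff, reachable_comap_iff, e.exists_congr_left,
    e.forall_congr_left, e.apply_symm_apply]

lemma IsTrifurcation.image (e : W ≃ V) {K : Set W} (h : IsTrifurcation (G.comap e) K) :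
    IsTrifurcation G (e '' K) := by
  have hK : K = e ⁻¹' (e '' K) := (e.injective.preimage_image K).symm
  have hKc : Kᶜ = e ⁻¹' (e '' K)ᶜ := by rw [Set.preimage_compl, ← hK]
  obtain ⟨hc, k, hk, s, h1, h2⟩ := h
  rw [hK, within_comap] at hc
  rw [hKc, within_comap] at h1 h2
  refine ⟨?_, e k, ⟨k, hk, rfl⟩, fun u => e (s u), fun u => ⟨?_, ?_⟩, fun u v huv => ?_⟩
  · rintro _ ⟨a, ha, rfl⟩ _ ⟨b, hb, rfl⟩
    exact (reachable_comap_iff e).1 (hc a ⟨a, ha, rfl⟩ b ⟨b, hb, rfl⟩)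
  · exact (infinite_comap_iff e).1 (h1 u).1
  · exact (reachable_comap_iff e).1 (h1 u).2
  · exact fun h => h2 u v huv ((reachable_comap_iff e).2 h)

end Graph

/-! ### Measurability -/

section Measurability

variable {Ω V : Type*} [MeasurableSpace Ω] {G : Ω → SimpleGraph V}

lemma measurable_within_adj (hG : ∀ x y, Measurable fun ω => (G ω).Adj x y) {A : Ω → Set V}
    (hA : ∀ x, Measurable fun ω => x ∈ A ω) (x y : V) :
    Measurable fun ω => (within (G ω) (A ω)).Adj x y :=
  (hG x y).and ((hA x).and (hA y))

variable [Countable V]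

/-- The type of walks depends on `ω`, so the event is decomposed by walk length, and by the first
step in the induction. -/
lemma measurable_reachable (hG : ∀ x y, Measurable fun ω => (G ω).Adj x y) (x y : V) :
    Measurable fun ω => (G ω).Reachable x y := by
  have h : ∀ n x, Measurable fun ω => ∃ w : (G ω).Walk x y, w.length = n := by
    intro n
    induction n with
    | zero =>
      intro x
      have : (fun ω => ∃ w : (G ω).Walk x y, w.length = 0) = fun _ => x = y := by
        ext ω
        exact SimpleGraph.Walk.exists_length_eq_zero_iff
      rw [this]
      exact measurable_const
    | succ n ih =>
      intro x
      have : (fun ω => ∃ w : (G ω).Walk x y, w.length = n + 1) =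
          fun ω => ∃ z, (G ω).Adj x z ∧ ∃ w : (G ω).Walk z y, w.length = n := by
        ext ω
        constructor
        · rintro ⟨w, hw⟩
          cases w with
          | nil => simp at hw
          | cons h w => exact ⟨_, h, w, by simpa using hw⟩
        · rintro ⟨z, h, w, hw⟩
          exact ⟨.cons h w, by simpa using hw⟩
      rw [this]
      exact Measurable.exists fun z => (hG x z).and (ih z)
  have : (fun ω => (G ω).Reachable x y) = fun ω => ∃ n, ∃ w : (G ω).Walk x y, w.length = n := by
    ext ω
    exact ⟨fun ⟨w⟩ => ⟨_, w, rfl⟩, fun ⟨_, w, _⟩ => ⟨w⟩⟩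
  rw [this]
  exact Measurable.exists fun n => h n x

lemma measurable_inInfinite (hG : ∀ x y, Measurable fun ω => (G ω).Adj x y) (x : V) :
    Measurable fun ω => InInfinite (G ω) x := by
  have : (fun ω => InInfinite (G ω) x) =
      fun ω => ¬ ∃ S : Finset V, ∀ y, (G ω).Reachable x y → y ∈ S := by
    ext ω
    refine not_congr ⟨fun h => ⟨h.toFinset, fun y hy => by simpa using hy⟩, fun ⟨S, hS⟩ =>
      S.finite_toSet.subset hS⟩
  rw [this]
  exact (Measurable.exists fun S => Measurable.forall fun y =>
    (measurable_reachable hG x y).imp measurable_const).not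

lemma measurable_hasUniqueInfinite (hG : ∀ x y, Measurable fun ω => (G ω).Adj x y) :
    Measurable fun ω => HasUniqueInfinite (G ω) :=
  Measurable.exists fun x => (measurable_inInfinite hG x).and <| Measurable.forall fun y =>
    (measurable_inInfinite hG y).imp (measurable_reachable hG x y)

lemma measurable_isTrifurcation (hG : ∀ x y, Measurable fun ω => (G ω).Adj x y) (K : Set V) :
    Measurable fun ω => IsTrifurcation (G ω) K := by
  have h := fun A : Set V => measurable_within_adj hG (A := fun _ => A) fun _ => measurable_const
  unfold IsTrifurcation
  refine Measurable.and ?_ ?_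
  · exact Measurable.forall fun a => measurable_const.imp <| Measurable.forall fun b =>
      measurable_const.imp (measurable_reachable (h K) a b)
  · refine Measurable.exists fun k => measurable_const.and <| Measurable.exists fun s =>
      Measurable.and (Measurable.forall fun u => ?_) (Measurable.forall fun u =>
      Measurable.forall fun v => measurable_const.imp (measurable_reachable (h Kᶜ) _ _).not)
    exact (measurable_inInfinite (h Kᶜ) (s u)).and (measurable_reachable hG _ _)

end Measurability

/-! ### Zero-one law and finite modification for product measures -/

section Product

variable {ι E : Type*} [MeasurableSpace E] (ν : Measure E) [IsProbabilityMeasure ν]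

lemma measurePreserving_precomp {f : ι → ι} (hf : Function.Injective f) :
    MeasurePreserving (fun (ω : ι → E) i => ω (f i)) (Measure.infinitePi fun _ => ν)
      (Measure.infinitePi fun _ => ν) :=
  ⟨by fun_prop, Measure.map_infinitePi_infinitePi_of_inj hf⟩

/-- Zero-one law: an event that is invariant under arbitrarily far shifts is trivial. -/
theorem measure_zero_or_one_of_shift_invariant {A : Set (ι → E)} (hA : MeasurableSet A)
    (h : ∀ s : Finset ι, ∃ f : ι → ι, Function.Injective f ∧ (∀ i ∈ s, f i ∉ s) ∧
      (fun (ω : ι → E) i => ω (f i)) ⁻¹' A = A) :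
    Measure.infinitePi (fun _ => ν) A = 0 ∨ Measure.infinitePi (fun _ => ν) A = 1 := by
  classical
  set P : Measure (ι → E) := Measure.infinitePi fun _ => ν with hP
  have hdense : P.MeasureDense (measurableCylinders fun _ : ι => E) :=
    .of_generateFrom_isSetAlgebra_finite _ isSetAlgebra_measurableCylinders
      generateFrom_measurableCylinders.symm
  -- For a cylinder `B` within `ε` of `A`, the event `B ∩ τ⁻¹' B` is within `2ε` of `A` by
  -- invariance. Its probability is the square of that of `B`, as `τ⁻¹' B` depends on disjoint
  -- coordinates; replacing that square by the square for `A` costs another `2ε`.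
  have key : ∀ ε : ℝ, 0 < ε → |P.real A - P.real A * P.real A| ≤ 4 * ε := by
    intro ε hε
    obtain ⟨B, hB, hAB⟩ := hdense.approx A hA (measure_ne_top _ _) ε hε
    have hBm := hdense.measurable B hB
    obtain ⟨s, S, hS, rfl⟩ := (mem_measurableCylinders B).1 hB
    obtain ⟨f, hf, hfs, hfA⟩ := h s
    set B : Set (ι → E) := cylinder (α := fun _ => E) s S
    set τ : (ι → E) → (ι → E) := fun ω i => ω (f i)
    have hτ : MeasurePreserving τ P P := measurePreserving_precomp ν hf
    have hab : P.real (symmDiff A B) ≤ ε := by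
      rw [measureReal_def]
      exact ENNReal.toReal_le_of_le_ofReal hε.le hAB.le
    have hτB : P.real (τ ⁻¹' B) = P.real B := by
      rw [measureReal_def, hτ.measure_preimage hBm.nullMeasurableSet, measureReal_def]
    have hτAB : P.real (symmDiff A (τ ⁻¹' B)) ≤ ε := by
      have : symmDiff A (τ ⁻¹' B) = τ ⁻¹' (symmDiff A B) := by
        rw [Set.preimage_symmDiff, hfA]
      rw [this, measureReal_def, hτ.measure_preimage (hA.symmDiff hBm).nullMeasurableSet]
      exact hab
    have hind : P.real (B ∩ τ ⁻¹' B) = P.real B * P.real B := by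
      have hi : iIndepFun (fun (i : ι) (ω : ι → E) => ω i) P :=
        iIndepFun_infinitePi (X := fun _ ω => ω) (by fun_prop)
      have hi' := hi.indepFun_finset s (s.image f) (by
        rw [Finset.disjoint_left]
        intro i hi hi'
        obtain ⟨j, hj, rfl⟩ := Finset.mem_image.1 hi'
        exact hfs j hj hi) (fun i => measurable_pi_apply i)
      let g : ((i : s.image f) → E) → ((i : s) → E) := fun ω i =>
        ω ⟨f i, Finset.mem_image_of_mem f i.2⟩
      have hg : Measurable g := by fun_prop
      have : P (B ∩ τ ⁻¹' B) = P B * P (τ ⁻¹' B) :=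
        hi'.measure_inter_preimage_eq_mul S (g ⁻¹' S) hS (hg hS)
      rw [measureReal_def, this, ENNReal.toReal_mul, ← measureReal_def, ← measureReal_def, hτB]
    have h1 : |P.real A - P.real B| ≤ ε :=
      (abs_measureReal_sub_le_measureReal_symmDiff hA.nullMeasurableSet hBm.nullMeasurableSet).trans hab
    have h2 : |P.real A - P.real (B ∩ τ ⁻¹' B)| ≤ 2 * ε := by
      refine (abs_measureReal_sub_le_measureReal_symmDiff hA.nullMeasurableSet
        (hBm.inter (hτ.measurable hBm)).nullMeasurableSet).trans ?_
      refine (measureReal_mono (s₂ := symmDiff A B ∪ symmDiff A (τ ⁻¹' B)) ?_).trans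
        ((measureReal_union_le _ _).trans (by linarith))
      intro ω
      simp only [Set.mem_symmDiff, Set.mem_inter_iff, Set.mem_union]
      tauto
    rw [hind] at h2
    have hA1 : P.real A ≤ 1 := measureReal_le_one
    have hB1 : P.real B ≤ 1 := measureReal_le_one
    have hA0 : 0 ≤ P.real A := measureReal_nonneg
    have hB0 : 0 ≤ P.real B := measureReal_nonneg
    rw [abs_le] at *
    constructor <;> nlinarith
  have h0 : P.real A - P.real A * P.real A = 0 := by
    rw [← abs_nonpos_iff]
    refine le_of_forall_pos_le_add fun ε hε => ?_
    have := key (ε / 4) (by positivity)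
    linarith
  have h1 : P.real A * (1 - P.real A) = 0 := by linarith
  rcases mul_eq_zero.1 h1 with h | h
  · exact .inl ((measureReal_eq_zero_iff).1 h)
  · right
    rw [← ENNReal.toReal_eq_one_iff]
    change P.real A = 1
    linarith

/-- Resetting finitely many coordinates to an atom of the marginal preserves null sets. -/
theorem measure_preimage_reset_eq_zero [DecidableEq ι] [MeasurableSingletonClass E] {e : E}
    (he : ν {e} ≠ 0) (s : Finset ι) {A : Set (ι → E)} (hA : MeasurableSet A)
    (h0 : Measure.infinitePi (fun _ => ν) A = 0) :
    Measure.infinitePi (fun _ => ν) ((fun ω i => if i ∈ s then e else ω i) ⁻¹' A) = 0 := by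
  set P : Measure (ι → E) := Measure.infinitePi fun _ => ν with hP
  have hi : iIndepFun (fun (i : ι) (ω : ι → E) => ω i) P :=
    iIndepFun_infinitePi (X := fun _ ω => ω) (by fun_prop)
  set m : ι → MeasurableSpace (ι → E) := fun i => MeasurableSpace.comap (fun ω => ω i) inferInstance
  have hind : Indep (⨆ i ∈ (s : Set ι), m i) (⨆ i ∈ (s : Set ι)ᶜ, m i) P :=
    indep_iSup_of_disjoint (fun i => (measurable_pi_apply i).comap_le) hi disjoint_compl_right
  set r : (ι → E) → (ι → E) := fun ω i => if i ∈ s then e else ω i with hr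
  have hD : MeasurableSet[⨆ i ∈ (s : Set ι), m i] (Set.pi (s : Set ι) fun _ => {e}) := by
    rw [Set.pi_def]
    refine @MeasurableSet.biInter _ _ (_) _ _ s.countable_toSet fun i hi => ?_
    exact (le_iSup₂ (f := fun i (_ : i ∈ (s : Set ι)) => m i) i hi) _
      ⟨{e}, measurableSet_singleton e, rfl⟩
  have hrm : @Measurable _ _ (⨆ i ∈ (s : Set ι)ᶜ, m i) _ r := by
    refine @measurable_pi_lambda _ _ _ (_) _ _ fun i => ?_
    by_cases his : i ∈ s
    · simp only [hr, his, if_true]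
      exact @measurable_const _ _ _ (_) _
    · simp only [hr, his, if_false]
      refine Measurable.mono (comap_measurable fun ω : ι → E => ω i) ?_ le_rfl
      exact le_iSup₂ (f := fun i (_ : i ∈ (s : Set ι)ᶜ) => m i) i (by simpa using his)
  -- `r` ignores the coordinates in `s`, so `r ⁻¹' A` is independent of the event that these all
  -- equal `e`. On that event `r` is the identity, so the intersection lies in `A` and is null,
  -- while the event itself has positive probability.
  have hmul := (Indep_iff _ _ P).1 hind _ _ hD (hrm hA)
  have hz : P (Set.pi (s : Set ι) (fun _ => {e}) ∩ r ⁻¹' A) = 0 := by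
    refine measure_mono_null ?_ h0
    rintro ω ⟨hω, hωA⟩
    have : r ω = ω := by
      ext i
      by_cases his : i ∈ s
      · simpa [hr, his] using (hω i his).symm
      · simp [hr, his]
    rwa [Set.mem_preimage, this] at hωA
  rw [hz, Measure.infinitePi_pi _ (fun i _ => measurableSet_singleton e), Finset.prod_const,
    eq_comm, mul_eq_zero] at hmul
  exact hmul.resolve_left (pow_ne_zero _ he)

end Product

variable {d : ℕ}

/-! ### The lattice -/

lemma neighborSet_lattice_finite (v : Fin d → ℤ) : ((lattice d).neighborSet v).Finite := by
  refine ((Set.finite_range fun i : Fin d => v + Pi.single i 1).union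
    (Set.finite_range fun i : Fin d => v - Pi.single i 1)).subset ?_
  rintro w ⟨i, rfl | h⟩
  · exact .inl ⟨i, rfl⟩
  · exact .inr ⟨i, by simp [h]⟩

/-- The vectors `v` such that every `x` is joined to `x + v` form a subgroup containing the unit
vectors. -/
lemma lattice_preconnected : (lattice d).Preconnected := by
  let S : AddSubgroup (Fin d → ℤ) :=
    { carrier := {v | ∀ x, (lattice d).Reachable x (x + v)}
      zero_mem' := fun x => by simp
      add_mem' := fun {a b} ha hb x => by
        rw [← add_assoc]; exact (ha x).trans (hb _)
      neg_mem' := fun {a} ha x => by simpa using (ha (x + -a)).symm }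
  have h1 : ∀ i, (Pi.single i 1 : Fin d → ℤ) ∈ S := fun i x =>
    reachable_of_adj ⟨i, .inl rfl⟩
  have h : ∀ v, v ∈ S := fun v => by
    rw [← Finset.univ_sum_single v]
    refine S.sum_mem fun i _ => ?_
    have : (Pi.single i (v i) : Fin d → ℤ) = v i • Pi.single i 1 := by
      rw [← Pi.single_smul]; simp
    rw [this]
    exact S.zsmul_mem (h1 i) _
  exact fun x y => by simpa using h (y - x) x

lemma lattice_comap_add (a : Fin d → ℤ) : (lattice d).comap (Equiv.addRight a) = lattice d := by
  ext x y
  simp only [SimpleGraph.comap_adj, Equiv.coe_addRight, lattice, add_right_comm _ a, add_left_inj]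

/-- Translation of edges. -/
def shiftEdge (a : Fin d → ℤ) (e : (lattice d).edgeSet) : (lattice d).edgeSet :=
  ⟨e.1.map (· + a), by
    obtain ⟨e, he⟩ := e
    induction e with
    | _ x y =>
      rw [SimpleGraph.mem_edgeSet, ← lattice_comap_add a] at he
      exact he⟩

lemma shiftEdge_injective (a : Fin d → ℤ) : Function.Injective (shiftEdge a) := fun _ _ h =>
  Subtype.ext (Sym2.map.injective (add_left_injective a) (congrArg Subtype.val h))

/-- Translation of configurations. -/
def shift (a : Fin d → ℤ) (ω : Config d) : Config d := fun e => ω (shiftEdge a e)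

lemma openGraph_shift (a : Fin d → ℤ) (ω : Config d) :
    openGraph (shift a ω) = (openGraph ω).comap (Equiv.addRight a) := by
  ext x y
  constructor
  · rintro ⟨h, hω⟩
    rw [← lattice_comap_add a] at h
    exact ⟨h, hω⟩
  · rintro ⟨h, hω⟩
    refine ⟨?_, hω⟩
    rw [← lattice_comap_add a]
    exact h

/-- The graph induced by the finite clusters, as a graph on all vertices. -/
def finiteGraph (ω : Config d) : SimpleGraph (Fin d → ℤ) :=
  within (lattice d) (finiteClusterSet ω)

lemma finiteGraph_shift (a : Fin d → ℤ) (ω : Config d) :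
    finiteGraph (shift a ω) = (finiteGraph ω).comap (Equiv.addRight a) := by
  have h : finiteClusterSet (shift a ω) = Equiv.addRight a ⁻¹' finiteClusterSet ω := by
    change finiteSet (openGraph (shift a ω)) = _
    rw [openGraph_shift, finiteSet_comap]
    rfl
  rw [finiteGraph, h, finiteGraph, ← within_comap, lattice_comap_add]

/-- Translation by `n` along one axis raises the sum of the endpoints' coordinates by `2n`, so each
ordered pair of edges of `s` rules out at most one `n`. -/
lemma exists_shiftEdge_notMem (hd : 1 ≤ d) (s : Finset (lattice d).edgeSet) :
    ∃ a : Fin d → ℤ, ∀ e ∈ s, shiftEdge a e ∉ s := by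
  let i : Fin d := ⟨0, hd⟩
  let t : ℕ → Fin d → ℤ := fun n => Pi.single i (n : ℤ)
  let φ : Sym2 (Fin d → ℤ) → ℤ := Sym2.lift ⟨fun x y => x i + y i, fun _ _ => add_comm _ _⟩
  have hφ : ∀ n (e : (lattice d).edgeSet), φ (shiftEdge (t n) e).1 = φ e.1 + 2 * n := by
    rintro n ⟨e, he⟩
    induction e with
    | _ x y => simp [φ, shiftEdge, t]; ring
  have hinj : ∀ e, Function.Injective fun n => shiftEdge (t n) e := fun e m n h => by
    have := congrArg (fun e => φ e.1) h
    simp only [hφ] at this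
    omega
  have hf : (⋃ e ∈ s, {n | shiftEdge (t n) e ∈ s}).Finite :=
    s.finite_toSet.biUnion fun e _ => s.finite_toSet.preimage (hinj e).injOn
  obtain ⟨n, hn⟩ := hf.infinite_compl.nonempty
  exact ⟨t n, fun e he h => hn (Set.mem_biUnion he h)⟩

/-! ### Closing the edges at a finite set -/

lemma finite_edges_touching (Λ : Finset (Fin d → ℤ)) :
    {e : (lattice d).edgeSet | ∃ v ∈ Λ, v ∈ e.1}.Finite := by
  refine Set.Finite.of_finite_image (f := Subtype.val) ?_ Subtype.val_injective.injOn
  refine (Λ.finite_toSet.biUnion fun v _ =>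
    (neighborSet_lattice_finite v).image fun w => s(v, w)).subset ?_
  rintro _ ⟨⟨e, he⟩, ⟨v, hv, hve⟩, rfl⟩
  obtain ⟨w, rfl⟩ := hve
  exact Set.mem_biUnion hv ⟨w, he, rfl⟩

/-- The edges with an endpoint in `Λ`. -/
def touching (Λ : Finset (Fin d → ℤ)) : Finset (lattice d).edgeSet :=
  (finite_edges_touching Λ).toFinset

lemma mem_touching {Λ : Finset (Fin d → ℤ)} {e : (lattice d).edgeSet} :
    e ∈ touching Λ ↔ ∃ v ∈ Λ, v ∈ e.1 :=
  (finite_edges_touching Λ).mem_toFinset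

open Classical in
/-- Close all edges with an endpoint in `Λ`. -/
def closeAt (Λ : Finset (Fin d → ℤ)) (ω : Config d) : Config d :=
  fun e => if e ∈ touching Λ then false else ω e

lemma openGraph_closeAt (Λ : Finset (Fin d → ℤ)) (ω : Config d) :
    openGraph (closeAt Λ ω) = within (openGraph ω) (Λ : Set (Fin d → ℤ))ᶜ := by
  ext x y
  constructor
  · rintro ⟨h, hω⟩
    have hn : (⟨s(x, y), h⟩ : (lattice d).edgeSet) ∉ touching Λ := fun hm => by
      simp [closeAt, hm] at hω
    refine ⟨⟨h, by simpa [closeAt, hn] using hω⟩, ?_⟩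
    simp only [mem_touching, not_exists, not_and] at hn
    exact ⟨fun hx => hn x hx (by simp), fun hy => hn y hy (by simp)⟩
  · rintro ⟨⟨h, hω⟩, hx, hy⟩
    have hn : (⟨s(x, y), h⟩ : (lattice d).edgeSet) ∉ touching Λ := by
      simp only [mem_touching, not_exists, not_and]
      rintro v hv hm
      rcases Sym2.mem_iff.1 hm with rfl | rfl
      exacts [hx hv, hy hv]
    exact ⟨h, by simpa [closeAt, hn] using hω⟩

lemma openGraph_le (ω : Config d) : openGraph ω ≤ lattice d := fun _ _ h => h.1

lemma finiteClusterSet_closeAt (Λ : Finset (Fin d → ℤ)) (ω : Config d) :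
    finiteClusterSet ω ⊆ finiteClusterSet (closeAt Λ ω) ∧
    (finiteClusterSet (closeAt Λ ω) \ finiteClusterSet ω).Finite ∧
    (Λ : Set (Fin d → ℤ)) ⊆ finiteClusterSet (closeAt Λ ω) := by
  have h : finiteClusterSet (closeAt Λ ω) =
      finiteSet (within (openGraph ω) (Λ : Set (Fin d → ℤ))ᶜ) := by
    rw [← openGraph_closeAt]; rfl
  rw [h]
  exact ⟨finiteSet_subset_within _, finite_finiteSet_within_diff
    (fun v => (neighborSet_lattice_finite v).subset fun _ h => openGraph_le ω h) Λ.finite_toSet,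
    subset_finiteSet_within⟩

/-! ### Measurability of the events -/

lemma measurable_openGraph_adj (x y : Fin d → ℤ) :
    Measurable fun ω : Config d => (openGraph ω).Adj x y := by
  refine Measurable.exists fun h => ?_
  exact (measurable_of_countable fun b : Bool => b = true).comp
    (measurable_pi_apply (⟨s(x, y), h⟩ : (lattice d).edgeSet))

lemma measurable_finiteGraph_adj (x y : Fin d → ℤ) :
    Measurable fun ω : Config d => (finiteGraph ω).Adj x y := by
  refine measurable_within_adj (fun _ _ => measurable_const) (fun x => ?_) x y
  have := (measurable_inInfinite (V := Fin d → ℤ) measurable_openGraph_adj x).not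
  simp only [InInfinite, Set.not_infinite] at this
  exact this

/-! ### Comparison with the induced graph -/

lemma reachable_finiteClusterGraph_iff (ω : Config d) (a b : finiteClusterSet ω) :
    (finiteClusterGraph ω).Reachable a b ↔ (finiteGraph ω).Reachable a b := by
  constructor
  · intro h
    exact h.map (⟨Subtype.val, fun {a b} hab => ⟨hab, a.2, b.2⟩⟩ :
      finiteClusterGraph ω →g finiteGraph ω)
  · intro h
    have := reachable_induction (P := fun z => ∀ hz : z ∈ finiteClusterSet ω,
      (finiteClusterGraph ω).Reachable a ⟨z, hz⟩) h (fun _ => .rfl)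
      fun u v _ huv ih hv => (ih huv.2.1).trans (reachable_of_adj (by exact huv.1))
    exact this b.2

lemma infinite_supp_iff (ω : Config d) (a : finiteClusterSet ω) :
    ((finiteClusterGraph ω).connectedComponentMk a).supp.Infinite ↔
      InInfinite (finiteGraph ω) a := by
  have : {z | (finiteGraph ω).Reachable a z} =
      Subtype.val '' ((finiteClusterGraph ω).connectedComponentMk a).supp := by
    ext z
    constructor
    · intro hz
      have hzX : z ∈ finiteClusterSet ω := mem_of_reachable_within hz a.2
      exact ⟨⟨z, hzX⟩, SimpleGraph.ConnectedComponent.eq.2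
        ((reachable_finiteClusterGraph_iff ω a ⟨z, hzX⟩).2 hz).symm, rfl⟩
    · rintro ⟨z, hz, rfl⟩
      exact (reachable_finiteClusterGraph_iff ω a z).1 (SimpleGraph.ConnectedComponent.eq.1 hz).symm
  rw [InInfinite, this, Set.infinite_image_iff Subtype.val_injective.injOn]

lemma exists_infinite_component_iff (ω : Config d) :
    (∃ C : (finiteClusterGraph ω).ConnectedComponent, C.supp.Infinite) ↔
      ∃ x, InInfinite (finiteGraph ω) x := by
  constructor
  · rintro ⟨C, hC⟩
    induction C using SimpleGraph.ConnectedComponent.ind with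
    | _ a => exact ⟨a, (infinite_supp_iff ω a).1 hC⟩
  · rintro ⟨x, hx⟩
    exact ⟨_, (infinite_supp_iff ω ⟨x, mem_of_infinite_within hx⟩).2 hx⟩

lemma existsUnique_infinite_component (ω : Config d) (h : HasUniqueInfinite (finiteGraph ω)) :
    ∃! C : (finiteClusterGraph ω).ConnectedComponent, C.supp.Infinite := by
  obtain ⟨x, hx, hu⟩ := h
  refine ⟨_, (infinite_supp_iff ω ⟨x, mem_of_infinite_within hx⟩).2 hx, fun C hC => ?_⟩
  induction C using SimpleGraph.ConnectedComponent.ind with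
  | _ a =>
    refine SimpleGraph.ConnectedComponent.eq.2 ((reachable_finiteClusterGraph_iff ω _ _).2 ?_)
    exact (hu a ((infinite_supp_iff ω a).1 hC)).symm

/-- The cluster contains a ray along an axis. This settles `p = 1`, where closing edges is not
permitted. -/
lemma not_mem_finiteClusterSet_of_forall_open (hd : 1 ≤ d) (x : Fin d → ℤ) :
    x ∉ finiteClusterSet (fun _ : (lattice d).edgeSet => true) := by
  intro h
  let i : Fin d := ⟨0, hd⟩
  have hr : ∀ n : ℕ, (openGraph fun _ : (lattice d).edgeSet => true).Reachable x
      (x + Pi.single i (n : ℤ)) := by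
    intro n
    induction n with
    | zero => simp
    | succ n ih =>
      refine ih.trans (reachable_of_adj ⟨⟨i, .inl ?_⟩, rfl⟩)
      rw [add_assoc, ← Pi.single_add]
      simp
  refine Set.infinite_of_injective_forall_mem (f := fun n : ℕ => x + Pi.single i (n : ℤ)) ?_
    (fun n => hr n) h
  intro m n hmn
  simpa using congrFun hmn i

/-! ### Trifurcations have probability zero -/

lemma sum_measure_le_of_card_le {Ω ι : Type*} [MeasurableSpace Ω] [Fintype ι] (P : Measure Ω)
    [IsProbabilityMeasure P] {E : ι → Set Ω} (hE : ∀ i, MeasurableSet (E i)) (N : ℕ)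
    (h : ∀ ω, ∀ J : Finset ι, (∀ i ∈ J, ω ∈ E i) → J.card ≤ N) : ∑ i, P (E i) ≤ N := by
  classical
  have h1 : ∀ i, P (E i) = ∫⁻ ω, (E i).indicator (fun _ => 1) ω ∂P := fun i => by
    rw [lintegral_indicator (hE i)]; simp
  simp_rw [h1]
  rw [← lintegral_finsetSum _ fun i _ => measurable_const.indicator (hE i)]
  refine (lintegral_mono (g := fun _ => (N : ENNReal)) fun ω => ?_).trans (by simp)
  have := h ω (Finset.univ.filter fun i => ω ∈ E i) (by simp)
  simp only [Set.indicator_apply, Finset.sum_boole]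
  exact_mod_cast this

instance (p : unitInterval) : IsProbabilityMeasure (percolation d p) := by
  unfold percolation; infer_instance

lemma measurePreserving_shift (p : unitInterval) (a : Fin d → ℤ) :
    MeasurePreserving (shift a) (percolation d p) (percolation d p) :=
  measurePreserving_precomp _ (shiftEdge_injective a)

lemma measurableSet_isTrifurcation (K : Set (Fin d → ℤ)) :
    MeasurableSet {ω : Config d | IsTrifurcation (finiteGraph ω) K} :=
  measurableSet_setOfPred.2 (measurable_isTrifurcation measurable_finiteGraph_adj K)

lemma measure_isTrifurcation_le_translate (p : unitInterval) (K : Set (Fin d → ℤ))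
    (a : Fin d → ℤ) :
    percolation d p {ω | IsTrifurcation (finiteGraph ω) K} ≤
      percolation d p {ω | IsTrifurcation (finiteGraph ω) (Equiv.addRight a '' K)} := by
  rw [← (measurePreserving_shift p a).measure_preimage
    (measurableSet_isTrifurcation K).nullMeasurableSet]
  refine measure_mono fun ω hω => ?_
  have hω : IsTrifurcation (finiteGraph (shift a ω)) K := hω
  rw [finiteGraph_shift] at hω
  exact hω.image _

/-- The half-open box with corners `a` and `b`. -/
def box (d : ℕ) (a b : ℤ) : Finset (Fin d → ℤ) := Fintype.piFinset fun _ => Finset.Ico a b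

lemma mem_box {a b : ℤ} {v : Fin d → ℤ} : v ∈ box d a b ↔ ∀ i, a ≤ v i ∧ v i < b := by
  simp [box]

lemma card_box (a b : ℤ) : (box d a b).card = (b - a).toNat ^ d := by
  simp [box]

lemma mem_box_of_adj {a b : ℤ} {u v : Fin d → ℤ} (huv : (lattice d).Adj u v)
    (hu : u ∈ box d a b) : v ∈ box d (a - 1) (b + 1) := by
  rw [mem_box] at *
  obtain ⟨i, h⟩ := huv
  intro j
  have hj := hu j
  have h01 : (Pi.single i 1 : Fin d → ℤ) j = 0 ∨ (Pi.single i 1 : Fin d → ℤ) j = 1 := by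
    by_cases hij : j = i
    · subst hij; simp
    · simp [hij]
  rcases h with h | h <;>
  · have := congrFun h j
    simp only [Pi.add_apply] at this
    omega

/-- The expected number of trifurcations in a large box is at most the size of its boundary. -/
lemma pow_mul_measure_isTrifurcation_le (p : unitInterval) {K : Set (Fin d → ℤ)} {R : ℕ}
    (hR : ∀ v ∈ K, ∀ i, |v i| ≤ R) (M : ℕ) :
    (M : ENNReal) ^ d * percolation d p {ω | IsTrifurcation (finiteGraph ω) K} ≤
      (((2 * R + 1) * M + 2) ^ d - ((2 * R + 1) * M) ^ d : ℕ) := by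
  classical
  -- As `K` lies in `[-R, R]^d`, translates by multiples of `2R + 1` are disjoint, and these `M ^ d`
  -- of them fill at most the half-open box from `-R` to `l - R`. The shell is one layer on each
  -- side.
  let o : (Fin d → Fin M) → Fin d → ℤ := fun z i => (2 * R + 1) * (z i : ℕ)
  let E : (Fin d → Fin M) → Set (Config d) := fun z =>
    {ω | IsTrifurcation (finiteGraph ω) (Equiv.addRight (o z) '' K)}
  set l : ℤ := (2 * R + 1) * M with hl
  have hcard : (box d (-R - 1) (l - R + 1) \ box d (-R) (l - R)).card =
      ((2 * R + 1) * M + 2) ^ d - ((2 * R + 1) * M) ^ d := by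
    rw [Finset.card_sdiff_of_subset, card_box, card_box]
    · congr 2
      all_goals
        have hN : (((2 * R + 1) * M : ℕ) : ℤ) = l := by push_cast [hl]; ring
        generalize (2 * R + 1) * M = N at hN ⊢
        omega
    · intro v hv
      rw [mem_box] at *
      intro i
      have := hv i
      omega
  have hsum : ∑ z, percolation d p (E z) ≤
      (((2 * R + 1) * M + 2) ^ d - ((2 * R + 1) * M) ^ d : ℕ) := by
    refine sum_measure_le_of_card_le _ (fun z => measurableSet_isTrifurcation _) _
      fun ω J hJ => ?_
    rw [← hcard]
    refine card_trifurcations_le (G := finiteGraph ω) (K := fun z => Equiv.addRight (o z) '' K)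
      J _ _ (fun u v huv hu => mem_box_of_adj huv.1 hu) ?_ hJ ?_
    · rintro z - _ ⟨v, hv, rfl⟩
      rw [Finset.mem_coe, mem_box]
      intro i
      have h1 := abs_le.1 (hR v hv i)
      have h2 : ((z i : ℕ) : ℤ) + 1 ≤ M := by exact_mod_cast (z i).2
      have h3 : (0 : ℤ) ≤ ((z i : ℕ) : ℤ) := by positivity
      simp only [Equiv.coe_addRight, Pi.add_apply, o, hl]
      constructor <;> nlinarith
    · rintro z - z' - hz
      rw [Set.disjoint_left]
      rintro _ ⟨v, hv, rfl⟩ ⟨w, hw, hvw⟩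
      refine hz (funext fun i => Fin.ext ?_)
      have h1 := abs_le.1 (hR v hv i)
      have h2 := abs_le.1 (hR w hw i)
      have h3 := congrFun hvw i
      simp only [Equiv.coe_addRight, Pi.add_apply, o] at h3
      by_contra hne
      rcases lt_or_gt_of_ne hne with h | h
      · have : ((z i : ℕ) : ℤ) + 1 ≤ (z' i : ℕ) := by exact_mod_cast h
        nlinarith
      · have : ((z' i : ℕ) : ℤ) + 1 ≤ (z i : ℕ) := by exact_mod_cast h
        nlinarith
  refine le_trans ?_ hsum
  refine le_trans (le_of_eq ?_) (Finset.sum_le_sum fun z _ =>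
    measure_isTrifurcation_le_translate p K (o z))
  simp

/-- Almost surely there is no trifurcation. -/
theorem measure_isTrifurcation_eq_zero (p : unitInterval) {K : Set (Fin d → ℤ)} (hK : K.Finite) :
    percolation d p {ω | IsTrifurcation (finiteGraph ω) K} = 0 := by
  obtain ⟨R, hR⟩ : ∃ R : ℕ, ∀ v ∈ K, ∀ i, |v i| ≤ R := by
    obtain ⟨R, hR⟩ := (hK.image fun v => ∑ i, (v i).natAbs).bddAbove
    refine ⟨R, fun v hv i => ?_⟩
    have h1 := hR ⟨v, hv, rfl⟩
    have h2 := Finset.single_le_sum (f := fun i => (v i).natAbs) (fun _ _ => Nat.zero_le _)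
      (Finset.mem_univ i)
    dsimp only at h1 h2
    rw [Int.abs_eq_natAbs]
    exact_mod_cast h2.trans h1
  set δ := (percolation d p).real {ω | IsTrifurcation (finiteGraph ω) K} with hδ
  -- The counting bound for `M + 1`, divided by `(M + 1) ^ d`; the shift keeps the divisor nonzero.
  have hle : ∀ M : ℕ, δ ≤ (2 * R + 1 + 2 / (M + 1 : ℝ)) ^ d - (2 * R + 1 : ℝ) ^ d := by
    intro M
    have h := ENNReal.toReal_mono (by simp) (pow_mul_measure_isTrifurcation_le p hR (M + 1))
    rw [ENNReal.toReal_mul, ENNReal.toReal_pow, ENNReal.toReal_natCast, ENNReal.toReal_natCast,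
      Nat.cast_sub (Nat.pow_le_pow_left (by omega) _)] at h
    push_cast at h
    have hM : (0 : ℝ) < M + 1 := by positivity
    have e1 : (2 * R + 1 + 2 / (M + 1 : ℝ)) = ((2 * R + 1) * (M + 1) + 2) / (M + 1 : ℝ) := by
      field_simp
    have e2 : (2 * R + 1 : ℝ) = ((2 * R + 1) * (M + 1)) / (M + 1 : ℝ) := by field_simp
    rw [e1]
    nth_rw 2 [e2]
    rw [div_pow, div_pow, ← sub_div, le_div_iff₀ (by positivity), mul_comm]
    exact h
  have hlim : Filter.Tendsto
      (fun M : ℕ => (2 * R + 1 + 2 / (M + 1 : ℝ)) ^ d - (2 * R + 1 : ℝ) ^ d) Filter.atTop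
      (nhds 0) := by
    have h0 : Filter.Tendsto (fun M : ℕ => 2 / (M + 1 : ℝ)) Filter.atTop (nhds 0) := by
      simpa [div_eq_mul_inv] using (tendsto_one_div_add_atTop_nhds_zero_nat (𝕜 := ℝ)).const_mul 2
    simpa using (((h0.const_add (2 * R + 1 : ℝ)).pow d).sub_const ((2 * R + 1 : ℝ) ^ d))
  exact (measureReal_eq_zero_iff).1 (le_antisymm (ge_of_tendsto' hlim hle) measureReal_nonneg)

/-! ### Zero-one law for uniqueness, and conclusion -/

lemma measurableSet_hasUniqueInfinite :
    MeasurableSet {ω : Config d | HasUniqueInfinite (finiteGraph ω)} :=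
  measurableSet_setOfPred.2 (measurable_hasUniqueInfinite measurable_finiteGraph_adj)

lemma measure_hasUniqueInfinite_zero_or_one (hd : 1 ≤ d) (p : unitInterval) :
    percolation d p {ω | HasUniqueInfinite (finiteGraph ω)} = 0 ∨
      percolation d p {ω | HasUniqueInfinite (finiteGraph ω)} = 1 := by
  refine measure_zero_or_one_of_shift_invariant _ measurableSet_hasUniqueInfinite fun s => ?_
  obtain ⟨a, ha⟩ := exists_shiftEdge_notMem hd s
  refine ⟨shiftEdge a, shiftEdge_injective a, ha, ?_⟩
  ext ω
  change HasUniqueInfinite (finiteGraph (shift a ω)) ↔ HasUniqueInfinite (finiteGraph ω)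
  rw [finiteGraph_shift, hasUniqueInfinite_comap_iff]

lemma measure_preimage_closeAt_eq_zero {p : unitInterval} (hp : p ≠ 1)
    (Λ : Finset (Fin d → ℤ)) {A : Set (Config d)} (hA : MeasurableSet A)
    (h0 : percolation d p A = 0) : percolation d p (closeAt Λ ⁻¹' A) = 0 := by
  classical
  have he : bernoulliMeasure true false p {false} ≠ 0 := by
    rw [bernoulliMeasure_apply_of_notMem_of_mem _ (by simp) (by simp) (by simp)]
    intro h
    have h1 := unitInterval.toNNReal_add_toNNReal_symm p
    rw [ENNReal.coe_eq_zero.1 h, add_zero] at h1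
    exact hp (Subtype.ext (congrArg NNReal.toReal h1))
  convert! measure_preimage_reset_eq_zero _ he (touching Λ) hA h0 using 3

/-- If almost surely there is not exactly one infinite component, there is almost surely none. -/
theorem ae_no_infinite {p : unitInterval} (hp : p ≠ 1)
    (h : percolation d p {ω | HasUniqueInfinite (finiteGraph ω)} = 0) :
    ∀ᵐ ω ∂percolation d p, ¬ ∃ x, InInfinite (finiteGraph ω) x := by
  set U : Set (Config d) := {ω | HasUniqueInfinite (finiteGraph ω)}
  set T : Set (Config d) := ⋃ K : Finset (Fin d → ℤ), {ω | IsTrifurcation (finiteGraph ω) K}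
  have hT : percolation d p T = 0 := measure_iUnion_null fun K =>
    measure_isTrifurcation_eq_zero p K.finite_toSet
  have hTm : MeasurableSet T := .iUnion fun K => measurableSet_isTrifurcation _
  have hclose : ∀ Λ : Finset (Fin d → ℤ), percolation d p (closeAt Λ ⁻¹' (U ∪ T)) = 0 := fun Λ =>
    measure_preimage_closeAt_eq_zero hp Λ (measurableSet_hasUniqueInfinite.union hTm)
      (measure_union_null h hT)
  rw [ae_iff]
  -- The suitable `Λ` depends on `ω`, but there are only countably many finite sets.
  refine measure_mono_null ?_ (measure_union_null h (measure_iUnion_null hclose))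
  intro ω hω
  have hω : ∃ x, InInfinite (finiteGraph ω) x := not_not.1 hω
  by_cases hu : HasUniqueInfinite (finiteGraph ω)
  · exact .inl hu
  obtain ⟨Λ, hΛ, hm⟩ := exists_finite_merging neighborSet_lattice_finite lattice_preconnected hω hu
  lift Λ to Finset (Fin d → ℤ) using hΛ
  obtain ⟨h1, h2, h3⟩ := finiteClusterSet_closeAt Λ ω
  refine .inr (Set.mem_iUnion.2 ⟨Λ, ?_⟩)
  rcases hm _ h1 h2 h3 with h | ⟨K, hK, h⟩
  · exact .inl h
  · lift K to Finset (Fin d → ℤ) using hK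
    exact .inr (Set.mem_iUnion.2 ⟨K, h⟩)

end FiniteClusters

end

theorem mainTheorem7 (d : ℕ) (hd : 1 ≤ d) (p : unitInterval) :
    (∀ᵐ ω ∂(FiniteClusters.percolation d p),
      ¬ ∃ C : (FiniteClusters.finiteClusterGraph ω).ConnectedComponent, C.supp.Infinite) ∨
    (∀ᵐ ω ∂(FiniteClusters.percolation d p),
      ∃! C : (FiniteClusters.finiteClusterGraph ω).ConnectedComponent, C.supp.Infinite) := by
  by_cases hp : p = 1
  · left
    have : FiniteClusters.percolation d p = Measure.dirac fun _ => true := by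
      simp [FiniteClusters.percolation, hp]
    rw [this, ae_dirac_eq]
    change ¬ _
    rw [FiniteClusters.exists_infinite_component_iff]
    rintro ⟨x, hx⟩
    exact FiniteClusters.not_mem_finiteClusterSet_of_forall_open hd x
      (FiniteClusters.mem_of_infinite_within hx)
  rcases FiniteClusters.measure_hasUniqueInfinite_zero_or_one hd p with h | h
  · left
    filter_upwards [FiniteClusters.ae_no_infinite hp h] with ω hω
    rwa [FiniteClusters.exists_infinite_component_iff]
  · right
    filter_upwards [(mem_ae_iff_prob_eq_one FiniteClusters.measurableSet_hasUniqueInfinite).2 h]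
      with ω hω
    exact FiniteClusters.existsUnique_infinite_component ω hω
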